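/- Let $\mathbb K$ be a field of characteristic $0$ and $V=\bigoplus_{d\in\mathbb Z}V^d$ a $\mathbb Z$-graded vector space over $\mathbb K$. Tensor products of homogeneous maps follow the Koszul rule $(f\otimes g)(x\otimes y)=(-1)^{|g||x|}f(x)\otimes g(y)$, and $I_k$ is the identity of $V^{\otimes k}$. For $\sigma\in\mathbb S_n$ and homogeneous $x_1,\dots,x_n\in V$ put $$\rho^{(2)}_\sigma(x_1\otimes\cdots\otimes x_n)=\operatorname{sgn}(\sigma)\,\epsilon(\sigma)\,x_{\sigma(1)}\otimes\cdots\otimes x_{\sigma(n)},$$ where the Koszul sign $\epsilon(\sigma)=\epsilon(\sigma;x_1,\dots,x_n)$ is the product of $(-1)^{|x_{\sigma(a)}||x_{\sigma(b)}|}$ over all $a<b$ with $\sigma(a)>\sigma(b)$; put $\rho^{(2)}_{w_n}=\sum_{\sigma\in\mathbb S_n}\rho^{(2)}_\sigma$. Let $Sh(n-1,1)$ be the set of $\sigma\in\mathbb S_n$ with $\sigma(1)<\cdots<\sigma(n-1)$. Let $\{\mu_n:V^{\otimes n}\to V\}_{n\ge1}$ be linear maps, $\mu_n$ homogeneous of degree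 $n-2$. Then $(V,\{\mu_n\})$ is called * an $A_\infty$-algebra if for all $n\ge1$ $$\sum_{i+j=n+1}\sum_{m=0}^{i-1}(-1)^{j(i-m-1)+m}\mu_i\circ(I_m\otimes\mu_j\otimes I_{i-m-1})=0;$$ * a $PL_\infty$-algebra if $\mu_n=\mu_n\circ(\rho^{(2)}_\sigma\otimes I_1)$ for all $n\ge 1$ and $\sigma\in\mathbb S_{n-1}$, and for all $n\ge1$ $$\sum_{i+j=n+1}\sum_{m=0}^{i-1}\frac{(-1)^{j(i-m-1)+m}}{(i-1)!\,(j-1)!}\mu_i\circ(I_m\otimes\mu_j\otimes I_{i-m-1})\circ(\rho^{(2)}_{w_{n-1}}\otimes I_1)=0;$$ * an $L_\infty$-algebra if $\mu_n=\mu_n\circ\rho^{(2)}_\sigma$ for all $n\ge1$ and $\sigma\in\mathbb S_n$, and for all $n\ge1$ $$\sum_{i+j=n+1}\sum_{m=0}^{i-1}\frac{(-1)^{j(i-m-1)+m}}{i!\,j!}\mu_i\circ(I_m\otimes\mu_j\otimes I_{i-m-1})\circ\rho^{(2)}_{w_{n}}=0.$$ (In all sums $i,j\ge1$.) For such a collection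 define $$\gamma(\mu_n)=\mu_n\circ(\rho^{(2)}_{w_{n-1}}\otimes I_1),\qquad \beta(\mu_n)=\mu_n\circ\sum_{\sigma\in Sh(n-1,1)}\rho^{(2)}_\sigma .$$ 1. If $(V,\{\mathfrak m_n\})$ is an $A_\infty$-algebra, then $(V,\{\gamma(\mathfrak m_n)\})$ is a $PL_\infty$-algebra. 2. If $(V,\{\mathfrak p_n\})$ is a $PL_\infty$-algebra, then $(V,\{\beta(\mathfrak p_n)\})$ is an $L_\infty$-algebra. -/

import Mathlib

namespace HomotopyAlg

open Finset

variable {K V : Type*} [Field K] [AddCommGroup V] [Module K V]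

/-- `Op K V n` is the space `Hom(V^{⊗ n}, V)`, written through multilinear maps in `n` variables. -/
abbrev Op (K V : Type*) [Field K] [AddCommGroup V] [Module K V] (n : ℕ) : Type _ :=
  MultilinearMap K (fun _ : Fin n => V) V

/-- `f` is homogeneous of degree `e`: it maps `V^{d₁} ⊗ ⋯ ⊗ V^{dₙ}` to `V^{d₁ + ⋯ + dₙ + e}`. -/
def IsHomogeneousOfDegree (𝒱 : ℤ → Submodule K V) {n : ℕ} (f : Op K V n) (e : ℤ) : Prop :=
  ∀ (d : Fin n → ℤ) (x : Fin n → V), (∀ k, x k ∈ 𝒱 (d k)) → f x ∈ 𝒱 ((∑ k, d k) + e)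

/-- The projection of `V` onto the sum of all `V^d` with `d` of parity `p`. -/
def parityProj (𝒱 : ℤ → Submodule K V) [DirectSum.Decomposition 𝒱] (p : ZMod 2) : V →ₗ[K] V :=
  DirectSum.toModule K ℤ V (fun d => if (d : ZMod 2) = p then (𝒱 d).subtype else 0) ∘ₗ
    (DirectSum.decomposeLinearEquiv 𝒱).toLinearMap

/-- The linear map with `x ↦ (-1) ^ (e * |x|) • x` for homogeneous `x`: the sign produced when a
map of degree `e` moves past `x`. -/
def passSign (𝒱 : ℤ → Submodule K V) [DirectSum.Decomposition 𝒱] (e : ℤ) : V →ₗ[K] V :=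
  DirectSum.toModule K ℤ V (fun d => (((e * d).negOnePow : ℤ) : K) • (𝒱 d).subtype) ∘ₗ
    (DirectSum.decomposeLinearEquiv 𝒱).toLinearMap

/-- The Koszul sign `ε(σ; x₁, …, xₙ)`, defined by
`x₁ ∧ ⋯ ∧ xₙ = ε(σ) x_{σ(1)} ∧ ⋯ ∧ x_{σ(n)}`, where `d k` is the parity of `x_k`: each pair that
`σ` puts in the wrong order contributes `(-1) ^ (|x| |y|)`. -/
def koszulSign {n : ℕ} (σ : Equiv.Perm (Fin n)) (d : Fin n → ZMod 2) : ℤˣ :=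
  ∏ q : Fin n × Fin n with q.1 < q.2 ∧ σ q.2 < σ q.1, (-1 : ℤˣ) ^ (d (σ q.1) * d (σ q.2))

/-- The operation `f ∘ ρ_σ`, where
`ρ_σ (x₁ ⊗ ⋯ ⊗ xₙ) = sgn(σ) ε(σ; x₁, …, xₙ) x_{σ(1)} ⊗ ⋯ ⊗ x_{σ(n)}` for homogeneous `x_k`.
General arguments are split into their even and odd parts; see `compRho_apply`. -/
def compRho (𝒱 : ℤ → Submodule K V) [DirectSum.Decomposition 𝒱] {n : ℕ}
    (σ : Equiv.Perm (Fin n)) (f : Op K V n) : Op K V n :=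
  ∑ P : Fin n → ZMod 2, (((Equiv.Perm.sign σ * koszulSign σ P : ℤˣ) : ℤ) : K) •
    (f.domDomCongr σ).compLinearMap (fun k => parityProj 𝒱 (P k))

/-- The permutation of `n + 1` letters that acts as `σ` on the first `n` and fixes the last one,
so that `ρ_{fixLast σ} = ρ_σ ⊗ I₁`. -/
def fixLast {n : ℕ} (σ : Equiv.Perm (Fin n)) : Equiv.Perm (Fin (n + 1)) :=
  finSuccEquivLast.symm.permCongr σ.optionCongr

/-- `(n, 1)`-unshuffles: permutations of `n + 1` letters that are increasing on the first `n`. -/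
def IsUnshuffleLast {n : ℕ} (σ : Equiv.Perm (Fin (n + 1))) : Prop :=
  StrictMono fun k : Fin n => σ k.castSucc

/-- The arguments of the outer operation in `f ∘ (I_m ⊗ g ⊗ I_{a-m})`, where `f` has `a + 1` and `g`
has `b + 1` inputs and `g` has degree `e`. -/
def insertArgs (𝒱 : ℤ → Submodule K V) [DirectSum.Decomposition 𝒱] {a b n : ℕ} (h : a + b = n)
    (g : Op K V (b + 1)) (e : ℤ) (m : Fin (a + 1)) (x : Fin (n + 1) → V) (k : Fin (a + 1)) : V :=
  if k < m then passSign 𝒱 e (x ⟨k, by omega⟩)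
  else if k = m then g (fun l => x ⟨m + l, by omega⟩)
  else x ⟨k + b, by omega⟩

theorem insertArgs_update (𝒱 : ℤ → Submodule K V) [DirectSum.Decomposition 𝒱] {a b n : ℕ}
    (h : a + b = n) (g : Op K V (b + 1)) (e : ℤ) (m : Fin (a + 1)) (x : Fin (n + 1) → V)
    (t : Fin (n + 1)) : ∃ (k : Fin (a + 1)) (L : V →ₗ[K] V), ∀ v : V,
      insertArgs 𝒱 h g e m (Function.update x t v) =
        Function.update (insertArgs 𝒱 h g e m x) k (L v) := by
  rcases lt_or_ge t.val m.val with h1 | h1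
  · refine ⟨⟨t, by omega⟩, passSign 𝒱 e, fun v => ?_⟩
    funext k
    by_cases hk : k = ⟨t, by omega⟩
    · subst hk
      simp [insertArgs, Fin.lt_def, h1]
    · have hk' : k.val ≠ t.val := fun hh => hk (Fin.ext hh)
      have e1 : (⟨k.val, by omega⟩ : Fin (n + 1)) ≠ t := fun hh => hk' (congrArg Fin.val hh)
      have e2 : ∀ l : Fin (b + 1), (⟨m.val + l.val, by omega⟩ : Fin (n + 1)) ≠ t := fun l hh => by
        have := congrArg Fin.val hh
        simp at this
        omega
      rw [Function.update_of_ne hk]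
      unfold insertArgs
      split_ifs with c1 c2
      · rw [Function.update_of_ne e1]
      · congr 1
        funext l
        rw [Function.update_of_ne (e2 l)]
      · rw [Function.update_of_ne]
        intro hh
        have := congrArg Fin.val hh
        simp only [Fin.lt_def] at c1
        simp at this
        omega
  rcases le_or_gt t.val (m.val + b) with h2 | h2
  · refine ⟨m, g.toLinearMap (fun l => x ⟨m + l, by omega⟩) ⟨t - m, by omega⟩, fun v => ?_⟩
    funext k
    by_cases hk : k = m
    · subst hk
      simp only [insertArgs, lt_self_iff_false, if_false, if_true, Function.update_self,
        MultilinearMap.toLinearMap_apply]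
      congr 1
      funext l
      by_cases hl : l = ⟨t - k, by omega⟩
      · subst hl
        rw [Function.update_self]
        have : (⟨k.val + (t.val - k.val), by omega⟩ : Fin (n + 1)) = t := Fin.ext (by simp; omega)
        rw [this, Function.update_self]
      · rw [Function.update_of_ne hl, Function.update_of_ne]
        intro hh
        apply hl
        have := congrArg Fin.val hh
        simp at this
        exact Fin.ext (by simp; omega)
    · have hk' : k.val ≠ m.val := fun hh => hk (Fin.ext hh)
      rw [Function.update_of_ne hk]
      unfold insertArgs
      rw [if_neg hk, if_neg hk]
      split_ifs with c1
      · rw [Function.update_of_ne]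
        intro hh
        have := congrArg Fin.val hh
        simp only [Fin.lt_def] at c1
        simp at this
        omega
      · rw [Function.update_of_ne]
        intro hh
        have := congrArg Fin.val hh
        simp only [Fin.lt_def] at c1
        simp at this
        omega
  · refine ⟨⟨t - b, by omega⟩, LinearMap.id, fun v => ?_⟩
    funext k
    by_cases hk : k = ⟨t - b, by omega⟩
    · subst hk
      have e1 : ¬ ((⟨t - b, by omega⟩ : Fin (a + 1)) < m) := by
        simp only [Fin.lt_def]; omega
      have e2 : ¬ ((⟨t - b, by omega⟩ : Fin (a + 1)) = m) := fun hh => by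
        have := congrArg Fin.val hh
        simp at this
        omega
      have e3 : (⟨(t.val - b) + b, by omega⟩ : Fin (n + 1)) = t := Fin.ext (by simp; omega)
      simp only [insertArgs, if_neg e1, if_neg e2, Function.update_self, LinearMap.id_apply, e3]
    · have hk' : k.val ≠ t.val - b := fun hh => hk (Fin.ext hh)
      rw [Function.update_of_ne hk]
      unfold insertArgs
      split_ifs with c1 c2
      · rw [Function.update_of_ne]
        intro hh
        have := congrArg Fin.val hh
        simp only [Fin.lt_def] at c1
        simp at this
        omega
      · congr 1
        funext l
        rw [Function.update_of_ne]
        intro hh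
        have := congrArg Fin.val hh
        simp at this
        omega
      · rw [Function.update_of_ne]
        intro hh
        have := congrArg Fin.val hh
        simp at this
        omega

/-- The operation `f ∘ (I_m ⊗ g ⊗ I_{a-m})` with `n + 1 = a + b + 1` inputs, where `f` has `a + 1`
inputs, `g` has `b + 1` inputs and degree `e`. For homogeneous arguments its value is
`(-1) ^ (e (|x₁| + ⋯ + |x_m|)) f(x₁, …, x_m, g(x_{m+1}, …, x_{m+b+1}), …, x_{n+1})`. -/
def insertOp (𝒱 : ℤ → Submodule K V) [DirectSum.Decomposition 𝒱] {a b n : ℕ} (h : a + b = n)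
    (f : Op K V (a + 1)) (g : Op K V (b + 1)) (e : ℤ) (m : Fin (a + 1)) : Op K V (n + 1) :=
  MultilinearMap.mk' (fun x => f (insertArgs 𝒱 h g e m x))
    (by
      intro x t u v
      obtain ⟨k, L, hL⟩ := insertArgs_update 𝒱 h g e m x t
      simp only [hL, map_add, MultilinearMap.map_update_add])
    (by
      intro x t c v
      obtain ⟨k, L, hL⟩ := insertArgs_update 𝒱 h g e m x t
      simp only [hL, map_smul, MultilinearMap.map_update_smul])

/-- A collection of operations, one for each number `≥ 1` of inputs: `μ n` is the operation with
`n + 1` inputs, usually written `μ_{n+1}`. -/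
abbrev Ops (K V : Type*) [Field K] [AddCommGroup V] [Module K V] : Type _ :=
  (n : ℕ) → Op K V (n + 1)

/-- The operation with `i` inputs has degree `i - 2`. -/
def HasDegrees (𝒱 : ℤ → Submodule K V) (μ : Ops K V) : Prop :=
  ∀ n : ℕ, IsHomogeneousOfDegree 𝒱 (μ n) (((n + 1 : ℕ) : ℤ) - 2)

/-- For `i = a + 1`, `j = b + 1`, `i + j = (n + 1) + 1`, the signed sum
`∑_{m=0}^{i-1} (-1) ^ (j (i - m - 1) + m) μ_i ∘ (I_m ⊗ μ_j ⊗ I_{i-m-1})`. -/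
def signedInsertions (𝒱 : ℤ → Submodule K V) [DirectSum.Decomposition 𝒱] (μ : Ops K V)
    {a b n : ℕ} (h : a + b = n) : Op K V (n + 1) :=
  ∑ m : Fin (a + 1), ((-1 : K) ^ ((b + 1) * (a - (m : ℕ)) + (m : ℕ))) •
    insertOp 𝒱 h (μ a) (μ b) (((b + 1 : ℕ) : ℤ) - 2) m

/-- `A_∞`-algebras, with `μ_n` of degree `n - 2`. -/
structure IsAInfinity (𝒱 : ℤ → Submodule K V) [DirectSum.Decomposition 𝒱] (μ : Ops K V) :
    Prop where
  degree : HasDegrees 𝒱 μ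
  relation : ∀ n : ℕ,
    ∑ p : antidiagonal n, signedInsertions 𝒱 μ (mem_antidiagonal.mp p.2) = 0

/-- `PL_∞`-algebras (homotopy pre-Lie algebras, left-symmetric version), with `μ_n` of degree
`n - 2`. In terms of `i = a + 1` and `j = b + 1` the coefficient is `1 / ((i - 1)! (j - 1)!)`. -/
structure IsPLInfinity (𝒱 : ℤ → Submodule K V) [DirectSum.Decomposition 𝒱] (μ : Ops K V) :
    Prop where
  degree : HasDegrees 𝒱 μ
  symmetry : ∀ (n : ℕ) (σ : Equiv.Perm (Fin n)), compRho 𝒱 (fixLast σ) (μ n) = μ n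
  relation : ∀ n : ℕ,
    ∑ p : antidiagonal n, (1 / ((p.1.1.factorial : K) * (p.1.2.factorial : K))) •
      ∑ σ : Equiv.Perm (Fin n),
        compRho 𝒱 (fixLast σ) (signedInsertions 𝒱 μ (mem_antidiagonal.mp p.2)) = 0

/-- `L_∞`-algebras, with `μ_n` of degree `n - 2`. In terms of `i = a + 1` and `j = b + 1` the
coefficient is `1 / (i! j!)`. By the symmetry, the `i` values of `m` give the same contribution
after antisymmetrization, so the relation is the usual
`∑_{i+j=n+1} (-1) ^ (j (i - 1)) ∑_{σ ∈ Sh(j, i-1)} sgn(σ) ε(σ) μ_i(μ_j(x_{σ(1)}, …), …) = 0`. -/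
structure IsLInfinity (𝒱 : ℤ → Submodule K V) [DirectSum.Decomposition 𝒱] (μ : Ops K V) :
    Prop where
  degree : HasDegrees 𝒱 μ
  symmetry : ∀ (n : ℕ) (σ : Equiv.Perm (Fin (n + 1))), compRho 𝒱 σ (μ n) = μ n
  relation : ∀ n : ℕ,
    ∑ p : antidiagonal n, (1 / (((p.1.1 + 1).factorial : K) * ((p.1.2 + 1).factorial : K))) •
      ∑ σ : Equiv.Perm (Fin (n + 1)),
        compRho 𝒱 σ (signedInsertions 𝒱 μ (mem_antidiagonal.mp p.2)) = 0

/-- `γ(μ_n) = μ_n ∘ ∑_{σ ∈ S_{n-1}} (ρ_σ ⊗ I₁)`. -/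
def gammaOp (𝒱 : ℤ → Submodule K V) [DirectSum.Decomposition 𝒱] (μ : Ops K V) : Ops K V :=
  fun n => ∑ σ : Equiv.Perm (Fin n), compRho 𝒱 (fixLast σ) (μ n)

open Classical in
/-- `β(μ_n) = μ_n ∘ ∑_{σ ∈ Sh(n-1,1)} ρ_σ`. -/
noncomputable def betaOp (𝒱 : ℤ → Submodule K V) [DirectSum.Decomposition 𝒱] (μ : Ops K V) :
    Ops K V :=
  fun n => ∑ σ : Equiv.Perm (Fin (n + 1)) with IsUnshuffleLast σ, compRho 𝒱 σ (μ n)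

/-- On homogeneous arguments `passSign` has the value it is meant to have. -/
theorem passSign_apply (𝒱 : ℤ → Submodule K V) [DirectSum.Decomposition 𝒱] (e d : ℤ) {x : V}
    (hx : x ∈ 𝒱 d) : passSign 𝒱 e x = (((e * d).negOnePow : ℤ) : K) • x := by
  lift x to 𝒱 d using hx
  rw [passSign, LinearMap.comp_apply, LinearEquiv.coe_coe, DirectSum.decomposeLinearEquiv_apply,
    DirectSum.decompose_coe, ← DirectSum.lof_eq_of K, DirectSum.toModule_lof]
  rfl

/-- On homogeneous arguments `parityProj` has the value it is meant to have. -/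
theorem parityProj_apply (𝒱 : ℤ → Submodule K V) [DirectSum.Decomposition 𝒱] (p : ZMod 2) (d : ℤ)
    {x : V} (hx : x ∈ 𝒱 d) : parityProj 𝒱 p x = if (d : ZMod 2) = p then x else 0 := by
  lift x to 𝒱 d using hx
  rw [parityProj, LinearMap.comp_apply, LinearEquiv.coe_coe, DirectSum.decomposeLinearEquiv_apply,
    DirectSum.decompose_coe, ← DirectSum.lof_eq_of K, DirectSum.toModule_lof]
  split_ifs <;> rfl

/-- On homogeneous arguments, `compRho` is precomposition with the signed permutation. -/
theorem compRho_apply (𝒱 : ℤ → Submodule K V) [DirectSum.Decomposition 𝒱] {n : ℕ}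
    (σ : Equiv.Perm (Fin n)) (f : Op K V n) (d : Fin n → ℤ) (x : Fin n → V)
    (hx : ∀ k, x k ∈ 𝒱 (d k)) :
    compRho 𝒱 σ f x = (((Equiv.Perm.sign σ * koszulSign σ (fun k => (d k : ZMod 2)) : ℤˣ) : ℤ) : K) •
      f (fun k => x (σ k)) := by
  rw [compRho, _root_.sum_apply, Finset.sum_eq_single (fun k => (d k : ZMod 2))]
  · simp [parityProj_apply 𝒱 _ _ (hx _)]
  · intro P _ hP
    obtain ⟨k, hk⟩ := Function.ne_iff.mp hP
    rw [_root_.smul_apply, MultilinearMap.compLinearMap_apply,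
      MultilinearMap.domDomCongr_apply, f.map_coord_zero (σ.symm k), smul_zero]
    simp [parityProj_apply 𝒱 _ _ (hx k), hk.symm]
  · simp

end HomotopyAlg

/-! The maps `compRho` form a left action of the symmetric group on operations (`compRho_mul`), and
the theorem follows from the equivariance of insertion under this action. The coefficient
(-1)^(j(i-m-1)+m) is exactly what removes all residual signs: permuting the inputs of the outer
operation by σ and inserting at slot m is the same as inserting into the original operation at slot
σ⁻¹ m and permuting all inputs; permuting the inputs of the inner operation only permutes the inputs
of the same insertion. Adjacent transpositions suffice, and the delicate one exchanges the inner
operation with a neighbouring input (`signedInsertion_compRho_swap_succ`).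

Symmetrization over a group of permutations of all inputs absorbs these permutations. Hence
replacing the outer and inner operations by sums of r and s permuted copies multiplies the
symmetrized sum over m by r s (`symmetrize_signedInsertion_sum`).

For γ the group is S_{n-1}, fixing the last letter, and r s = (i-1)!(j-1)! cancels the coefficient,
leaving the symmetrized A_∞ relation. For β the group is S_n and r s = i j turns 1/(i! j!) into
1/((i-1)!(j-1)!), leaving the PL_∞ relation symmetrized over S_n. That relation already carries a
sum over S_{n-1}, which only contributes the factor (n-1)!, invertible in characteristic 0.

The symmetry of γ is invariance of a sum over a group; that of β holds because the unshuffles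
represent the cosets of S_{n-1} in S_n. -/

namespace HomotopyAlg

open Finset

variable {K V : Type*} [Field K] [AddCommGroup V] [Module K V]

/-! ### Koszul signs and the signed action on operations -/

/-- Permuting the letters permutes the unordered pairs of letters. -/
theorem prod_lt_comp_perm {M : Type*} [CommMonoid M] {n : ℕ} (σ : Equiv.Perm (Fin n))
    (h : Fin n → Fin n → M) (hs : ∀ u v, h u v = h v u) :
    ∏ q : Fin n × Fin n with q.1 < q.2, h (σ q.1) (σ q.2) =
      ∏ q : Fin n × Fin n with q.1 < q.2, h q.1 q.2 := by
  refine Finset.prod_bij'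
    (fun q _ => if σ q.1 < σ q.2 then (σ q.1, σ q.2) else (σ q.2, σ q.1))
    (fun q _ => if σ.symm q.1 < σ.symm q.2 then (σ.symm q.1, σ.symm q.2)
      else (σ.symm q.2, σ.symm q.1)) ?_ ?_ ?_ ?_ ?_
  · rintro ⟨a, b⟩ hq
    simp only [mem_filter, mem_univ, true_and] at hq ⊢
    have hne : σ a ≠ σ b := fun hh => hq.ne (σ.injective hh)
    split_ifs with c
    · exact c
    · exact lt_of_le_of_ne (not_lt.mp c) hne.symm
  · rintro ⟨a, b⟩ hq
    simp only [mem_filter, mem_univ, true_and] at hq ⊢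
    have hne : σ.symm a ≠ σ.symm b := fun hh => hq.ne (σ.symm.injective hh)
    split_ifs with c
    · exact c
    · exact lt_of_le_of_ne (not_lt.mp c) hne.symm
  · rintro ⟨a, b⟩ hq
    simp only [mem_filter, mem_univ, true_and] at hq
    dsimp only
    split_ifs with c <;> simp_all [hq.not_gt]
  · rintro ⟨a, b⟩ hq
    simp only [mem_filter, mem_univ, true_and] at hq
    dsimp only
    split_ifs with c <;> simp_all [hq.not_gt]
  · rintro ⟨a, b⟩ _
    dsimp only
    split_ifs with c
    · rfl
    · exact hs _ _

/-- A pair is inverted by τσ exactly when one of σ (on the pair) and τ (on its image) inverts it,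
and two inversions contribute a square of a sign. -/
theorem koszulSign_mul {n : ℕ} (τ σ : Equiv.Perm (Fin n)) (d : Fin n → ZMod 2) :
    koszulSign (τ * σ) d = koszulSign τ d * koszulSign σ (fun k => d (τ k)) := by
  -- The contribution of {u, v} to the sign of τ, made symmetric in u and v so that the product over
  -- pairs can be reindexed along σ.
  let h : Fin n → Fin n → ℤˣ := fun u v =>
    if (u < v ∧ τ v < τ u) ∨ (v < u ∧ τ u < τ v) then (-1 : ℤˣ) ^ (d (τ u) * d (τ v)) else 1
  have hτ : koszulSign τ d = ∏ q : Fin n × Fin n with q.1 < q.2, h q.1 q.2 := by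
    rw [koszulSign, ← Finset.filter_filter, Finset.prod_filter]
    refine Finset.prod_congr rfl fun q hq => ?_
    have hq : q.1 < q.2 := by simpa using hq
    simp [h, hq, hq.not_gt]
  have hs : ∀ u v, h u v = h v u := by
    intro u v
    simp only [h, mul_comm (d (τ u)), or_comm]
  rw [hτ, ← prod_lt_comp_perm σ h hs, koszulSign, koszulSign, ← Finset.filter_filter,
    ← Finset.filter_filter, Finset.prod_filter, Finset.prod_filter (fun q : Fin n × Fin n => σ q.2 < σ q.1),
    ← Finset.prod_mul_distrib]
  refine Finset.prod_congr rfl fun q hq => ?_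
  have hq : q.1 < q.2 := by simpa using hq
  have hne : σ q.1 ≠ σ q.2 := fun hh => hq.ne (σ.injective hh)
  have hne' : τ (σ q.1) ≠ τ (σ q.2) := fun hh => hne (τ.injective hh)
  simp only [h, Equiv.Perm.mul_apply]
  rcases lt_or_gt_of_ne hne with h1 | h1 <;> rcases lt_or_gt_of_ne hne' with h2 | h2 <;>
    simp [h1, h2, h1.not_gt, h2.not_gt, Int.units_mul_self]

/-- Multilinear maps that agree on homogeneous arguments are equal. -/
theorem op_ext_homogeneous (𝒱 : ℤ → Submodule K V) [DirectSum.Decomposition 𝒱] {n : ℕ}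
    {f g : Op K V n}
    (h : ∀ (d : Fin n → ℤ) (x : Fin n → V), (∀ k, x k ∈ 𝒱 (d k)) → f x = g x) : f = g := by
  classical
  ext x
  have hx : x = fun k => ∑ i ∈ (DirectSum.decompose 𝒱 (x k)).support,
      (DirectSum.decompose 𝒱 (x k) i : V) :=
    funext fun k => (DirectSum.sum_support_decompose 𝒱 (x k)).symm
  rw [hx, f.map_sum_finset (fun k i => (DirectSum.decompose 𝒱 (x k) i : V)),
    g.map_sum_finset (fun k i => (DirectSum.decompose 𝒱 (x k) i : V))]
  exact Finset.sum_congr rfl fun r _ => h r _ fun k => SetLike.coe_mem _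

section

variable (𝒱 : ℤ → Submodule K V) [DirectSum.Decomposition 𝒱] {n : ℕ}

theorem compRho_mul (τ σ : Equiv.Perm (Fin n)) (f : Op K V n) :
    compRho 𝒱 (τ * σ) f = compRho 𝒱 τ (compRho 𝒱 σ f) := by
  refine op_ext_homogeneous 𝒱 fun d x hx => ?_
  rw [compRho_apply 𝒱 _ _ d x hx, compRho_apply 𝒱 τ _ d x hx,
    compRho_apply 𝒱 σ f (fun k => d (τ k)) _ fun k => hx (τ k), smul_smul, koszulSign_mul,
    Equiv.Perm.sign_mul]
  congr 1
  push_cast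
  ring

theorem compRho_one (f : Op K V n) : compRho 𝒱 1 f = f := by
  refine op_ext_homogeneous 𝒱 fun d x hx => ?_
  rw [compRho_apply 𝒱 _ _ d x hx, koszulSign, Finset.filter_false_of_mem]
  · simp
  · rintro q - ⟨h1, h2⟩
    exact h1.not_gt h2

theorem compRho_sum (σ : Equiv.Perm (Fin n)) {ι : Type*} (s : Finset ι) (f : ι → Op K V n) :
    compRho 𝒱 σ (∑ i ∈ s, f i) = ∑ i ∈ s, compRho 𝒱 σ (f i) := by
  refine op_ext_homogeneous 𝒱 fun d x hx => ?_
  simp only [_root_.sum_apply, compRho_apply 𝒱 _ _ d x hx, Finset.smul_sum]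

theorem compRho_smul (σ : Equiv.Perm (Fin n)) (c : K) (f : Op K V n) :
    compRho 𝒱 σ (c • f) = c • compRho 𝒱 σ f := by
  refine op_ext_homogeneous 𝒱 fun d x hx => ?_
  simp only [_root_.smul_apply, compRho_apply 𝒱 _ _ d x hx, smul_comm c]

variable {𝒱}

theorem IsHomogeneousOfDegree.compRho {f : Op K V n} {e : ℤ} (hf : IsHomogeneousOfDegree 𝒱 f e)
    (σ : Equiv.Perm (Fin n)) : IsHomogeneousOfDegree 𝒱 (compRho 𝒱 σ f) e := by
  intro d x hx
  rw [compRho_apply 𝒱 _ _ d x hx, ← Equiv.sum_comp σ d]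
  exact Submodule.smul_mem _ _ (hf _ _ fun k => hx (σ k))

end

theorem IsHomogeneousOfDegree.sum {𝒱 : ℤ → Submodule K V} {n : ℕ} {ι : Type*} {s : Finset ι} 
    {f : ι → Op K V n} {e : ℤ}
    (hf : ∀ i ∈ s, IsHomogeneousOfDegree 𝒱 (f i) e) :
    IsHomogeneousOfDegree 𝒱 (∑ i ∈ s, f i) e := by
  intro d x hx
  rw [_root_.sum_apply]
  exact Submodule.sum_mem _ fun i hi => hf i hi d x hx

/-! ### Unshuffles and the subgroup fixing the last letter -/

/-- The permutation of `n + 1` letters that is increasing on the first `n` and maps the last letter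
to `k`. -/
def unshuffle {n : ℕ} (k : Fin (n + 1)) : Equiv.Perm (Fin (n + 1)) :=
  finSuccEquivLast.trans (finSuccEquiv' k).symm

@[simp]
theorem unshuffle_last {n : ℕ} (k : Fin (n + 1)) : unshuffle k (Fin.last n) = k := by
  simp [unshuffle]

@[simp]
theorem unshuffle_castSucc {n : ℕ} (k : Fin (n + 1)) (i : Fin n) :
    unshuffle k i.castSucc = k.succAbove i := by
  simp [unshuffle]

theorem isUnshuffleLast_iff {n : ℕ} (σ : Equiv.Perm (Fin (n + 1))) :
    IsUnshuffleLast σ ↔ unshuffle (σ (Fin.last n)) = σ := by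
  constructor
  · intro hσ
    -- Both maps are strictly increasing and miss only the value of σ at the last letter; a strictly
    -- increasing map from `Fin n` is determined by its range.
    have key : (σ (Fin.last n)).succAbove = fun k : Fin n => σ k.castSucc := by
      refine (StrictMono.range_inj (Fin.strictMono_succAbove _) hσ).mp ?_
      rw [Fin.range_succAbove]
      ext y
      obtain ⟨z, rfl⟩ := σ.surjective y
      induction z using Fin.lastCases with
      | last => simp [(Fin.castSucc_lt_last _).ne]
      | cast i => simp [(Fin.castSucc_lt_last _).ne]
    ext i : 1
    induction i using Fin.lastCases with
    | last => simp
    | cast i => simp [congrFun key i]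
  · intro h
    rw [← h, IsUnshuffleLast]
    simpa using Fin.strictMono_succAbove _

theorem betaOp_eq_sum_unshuffle (𝒱 : ℤ → Submodule K V) [DirectSum.Decomposition 𝒱]
    (μ : Ops K V) (n : ℕ) : betaOp 𝒱 μ n = ∑ k, compRho 𝒱 (unshuffle k) (μ n) := by
  classical
  rw [betaOp]
  refine Finset.sum_bij' (fun σ _ => σ (Fin.last n)) (fun k _ => unshuffle k) ?_ ?_ ?_ ?_ ?_
  · simp
  · intro k _
    simp [isUnshuffleLast_iff]
  · intro σ hσ
    exact (isUnshuffleLast_iff σ).mp (by simpa using hσ)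
  · simp
  · intro σ hσ
    rw [(isUnshuffleLast_iff σ).mp (by simpa using hσ)]

@[simp]
theorem fixLast_castSucc {n : ℕ} (σ : Equiv.Perm (Fin n)) (i : Fin n) :
    fixLast σ i.castSucc = (σ i).castSucc := by
  simp [fixLast]

@[simp]
theorem fixLast_last {n : ℕ} (σ : Equiv.Perm (Fin n)) :
    fixLast σ (Fin.last n) = Fin.last n := by
  simp [fixLast]

/-- `fixLast` as a homomorphism of groups. -/
def fixLastHom (n : ℕ) : Equiv.Perm (Fin n) →* Equiv.Perm (Fin (n + 1)) where
  toFun := fixLast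
  map_one' := by
    ext i : 1
    induction i using Fin.lastCases <;> simp
  map_mul' σ τ := by
    ext i : 1
    induction i using Fin.lastCases <;> simp

theorem fixLastHom_apply {n : ℕ} (σ : Equiv.Perm (Fin n)) : fixLastHom n σ = fixLast σ := rfl

theorem mem_range_fixLastHom {n : ℕ} {π : Equiv.Perm (Fin (n + 1))}
    (h : π (Fin.last n) = Fin.last n) : π ∈ (fixLastHom n).range := by
  -- Under `finSuccEquivLast` the last letter becomes `none`, which π fixes, so removing `none`
  -- restricts π to the other letters.
  refine ⟨Equiv.removeNone (finSuccEquivLast.permCongr π), ?_⟩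
  ext i : 1
  induction i using Fin.lastCases with
  | last => simp [fixLastHom_apply, h]
  | cast i =>
    rw [fixLastHom_apply, fixLast_castSucc]
    apply finSuccEquivLast.injective
    rw [finSuccEquivLast_castSucc, Equiv.removeNone_some]
    · simp
    · have hne : π i.castSucc ≠ Fin.last n := fun hh =>
        (Fin.castSucc_lt_last i).ne (π.injective (hh.trans h.symm))
      obtain ⟨j, hj⟩ := Fin.exists_castSucc_eq.mpr hne
      exact ⟨j, by simp [← hj]⟩

/-- `β(μ_n)` is symmetric if `μ_n` is symmetric in all arguments but the last. -/
theorem compRho_sum_unshuffle (𝒱 : ℤ → Submodule K V) [DirectSum.Decomposition 𝒱] {n : ℕ}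
    {f : Op K V (n + 1)} (hf : ∀ σ : Equiv.Perm (Fin n), compRho 𝒱 (fixLast σ) f = f)
    (π : Equiv.Perm (Fin (n + 1))) :
    compRho 𝒱 π (∑ k, compRho 𝒱 (unshuffle k) f) = ∑ k, compRho 𝒱 (unshuffle k) f := by
  rw [compRho_sum, ← Equiv.sum_comp π fun k => compRho 𝒱 (unshuffle k) f]
  refine Finset.sum_congr rfl fun k _ => ?_
  -- Both π * `unshuffle k` and `unshuffle (π k)` send the last letter to π k, so they differ by a
  -- right factor fixing the last letter, which f absorbs.
  obtain ⟨σ, hσ⟩ := mem_range_fixLastHom (π := (unshuffle (π k))⁻¹ * (π * unshuffle k))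
    (by rw [Equiv.Perm.mul_apply, Equiv.Perm.inv_eq_iff_eq]; simp)
  rw [← compRho_mul, eq_mul_of_inv_mul_eq hσ.symm, fixLastHom_apply, compRho_mul, hf]

/-! ### Cyclic permutations of an interval of letters -/

theorem val_cycleIcc {n m l : ℕ} (h : m + l < n + 1) (k : Fin (n + 1)) :
    (Fin.cycleIcc (⟨m, by omega⟩ : Fin (n + 1)) ⟨m + l, h⟩ k).val =
      if k.val < m then k.val else if k.val < m + l then k.val + 1
        else if k.val = m + l then m else k.val := by
  have hij : (⟨m, by omega⟩ : Fin (n + 1)) ≤ ⟨m + l, h⟩ := by simp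
  split_ifs with h1 h2 h3
  · rw [Fin.cycleIcc_of_lt (Fin.lt_def.mpr h1)]
  · rw [Fin.cycleIcc_of_ge_of_lt (Fin.le_def.mpr (by simpa using h1)) (Fin.lt_def.mpr h2),
      Fin.val_add_one_of_lt']
    omega
  · obtain rfl : k = ⟨m + l, h⟩ := Fin.ext h3
    rw [Fin.cycleIcc_of_last hij]
  · rw [Fin.cycleIcc_of_gt (Fin.lt_def.mpr (by simp; omega))]

/-- Precomposition with this cycle moves the argument at m behind the next l arguments, so the
inverted pairs are those formed by position m + l and each of the l positions before it. -/
theorem koszulSign_cycleIcc {n m l : ℕ} (h : m + l < n + 1) (d : Fin (n + 1) → ZMod 2) :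
    koszulSign (Fin.cycleIcc ⟨m, by omega⟩ ⟨m + l, h⟩) d =
      ∏ i : Fin l, (-1 : ℤˣ) ^ (d ⟨m + i + 1, by omega⟩ * d ⟨m, by omega⟩) := by
  symm
  refine Finset.prod_bij (fun i _ => (⟨m + i, by omega⟩, ⟨m + l, h⟩)) ?_ ?_ ?_ ?_
  · intro i _
    simp only [mem_filter, mem_univ, true_and, Fin.lt_def, val_cycleIcc h]
    have := i.2
    split_ifs <;> omega
  · intro i _ j _ hij
    have := congrArg (fun q => q.1.val) hij
    exact Fin.ext (by simpa using this)
  · rintro ⟨u, v⟩ huv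
    simp only [mem_filter, mem_univ, true_and, Fin.lt_def, val_cycleIcc h] at huv
    have h1 : m ≤ u.val ∧ u.val < m + l ∧ v.val = m + l := by
      have := u.2
      have := v.2
      obtain ⟨h1, h2⟩ := huv
      split_ifs at h2 <;> omega
    refine ⟨⟨u.val - m, by omega⟩, mem_univ _, ?_⟩
    ext
    · simp; omega
    · simp; omega
  · intro i _
    have := i.2
    congr 3
    · congr 1
      refine Eq.trans ?_ (val_cycleIcc h _).symm
      simp
    · congr 1
      refine Eq.trans ?_ (val_cycleIcc h _).symm
      simp

theorem sign_cycleIcc {n m l : ℕ} (h : m + l < n + 1) :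
    Equiv.Perm.sign (Fin.cycleIcc (⟨m, by omega⟩ : Fin (n + 1)) ⟨m + l, h⟩) = (-1) ^ l := by
  rw [Fin.sign_cycleIcc_of_le (by simp)]
  simp

theorem swap_eq_cycleIcc {n : ℕ} (k : Fin n) :
    Equiv.swap k.castSucc k.succ = Fin.cycleIcc ⟨k, by omega⟩ ⟨k + 1, by omega⟩ := by
  ext i
  rw [val_cycleIcc, Equiv.swap_apply_def]
  simp only [Fin.ext_iff, Fin.val_castSucc, Fin.val_succ]
  split_ifs <;> simp <;> omega

theorem compRho_cycleIcc_apply (𝒱 : ℤ → Submodule K V) [DirectSum.Decomposition 𝒱]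
    {n m l : ℕ} (hm : m + l < n + 1) (f : Op K V (n + 1))
    (d : Fin (n + 1) → ℤ) (x : Fin (n + 1) → V) (hx : ∀ k, x k ∈ 𝒱 (d k)) :
    compRho 𝒱 (Fin.cycleIcc ⟨m, by omega⟩ ⟨m + l, hm⟩) f x =
      ((((-1) ^ l * ∏ i : Fin l, (-1 : ℤˣ) ^ ((d ⟨m + i + 1, by omega⟩ : ZMod 2) *
        (d ⟨m, by omega⟩ : ZMod 2)) : ℤˣ) : ℤ) : K) •
      f (fun k => x (Fin.cycleIcc ⟨m, by omega⟩ ⟨m + l, hm⟩ k)) := by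
  rw [compRho_apply 𝒱 _ _ d x hx, sign_cycleIcc, koszulSign_cycleIcc]

theorem compRho_swap_apply (𝒱 : ℤ → Submodule K V) [DirectSum.Decomposition 𝒱] {n : ℕ}
    (k : Fin n) (f : Op K V (n + 1))
    (d : Fin (n + 1) → ℤ) (x : Fin (n + 1) → V) (hx : ∀ k, x k ∈ 𝒱 (d k)) :
    compRho 𝒱 (Equiv.swap k.castSucc k.succ) f x =
      (((-(-1 : ℤˣ) ^ ((d k.castSucc : ZMod 2) * (d k.succ : ZMod 2)) : ℤˣ) : ℤ) : K) •
      f (fun i => x (Equiv.swap k.castSucc k.succ i)) := by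
  rw [swap_eq_cycleIcc, compRho_cycleIcc_apply 𝒱 (n := n) (m := k) (l := 1) (by omega) f d x hx,
    Fin.prod_univ_one, pow_one, neg_one_mul, mul_comm]
  rfl

/-! ### Insertions and their degrees -/

section

variable (𝒱 : ℤ → Submodule K V) [DirectSum.Decomposition 𝒱] {a b n : ℕ} (h : a + b = n)

theorem insertOp_apply (f : Op K V (a + 1)) (g : Op K V (b + 1)) (e : ℤ) (m : Fin (a + 1))
    (x : Fin (n + 1) → V) : insertOp 𝒱 h f g e m x = f (insertArgs 𝒱 h g e m x) := rfl

theorem insertArgs_of_lt (g : Op K V (b + 1)) (e : ℤ) {m k : Fin (a + 1)} (hk : k.val < m.val)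
    (x : Fin (n + 1) → V) : insertArgs 𝒱 h g e m x k = passSign 𝒱 e (x ⟨k, by omega⟩) :=
  if_pos hk

theorem insertArgs_of_eq (g : Op K V (b + 1)) (e : ℤ) {m k : Fin (a + 1)} (hk : k.val = m.val)
    (x : Fin (n + 1) → V) :
    insertArgs 𝒱 h g e m x k = g fun l => x ⟨m + l, by omega⟩ := by
  obtain rfl : k = m := Fin.ext hk
  simp [insertArgs]

theorem insertArgs_of_gt (g : Op K V (b + 1)) (e : ℤ) {m k : Fin (a + 1)} (hk : m.val < k.val)
    (x : Fin (n + 1) → V) : insertArgs 𝒱 h g e m x k = x ⟨k + b, by omega⟩ :=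
  (if_neg (Fin.lt_def.not.mpr hk.not_gt)).trans (if_neg (Fin.ext_iff.not.mpr hk.ne'))

theorem insertOp_sum_left {ι : Type*} (s : Finset ι) (f : ι → Op K V (a + 1))
    (g : Op K V (b + 1)) (e : ℤ) (m : Fin (a + 1)) :
    insertOp 𝒱 h (∑ i ∈ s, f i) g e m = ∑ i ∈ s, insertOp 𝒱 h (f i) g e m := by
  ext x
  simp only [insertOp_apply, _root_.sum_apply]

/-- The inner operation enters through slot m alone, which gives linearity in it and lets signs be
moved into that slot. -/
theorem insertArgs_eq_update (g g' : Op K V (b + 1)) (e : ℤ) (m : Fin (a + 1))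
    (x : Fin (n + 1) → V) : insertArgs 𝒱 h g e m x =
      Function.update (insertArgs 𝒱 h g' e m x) m (g fun l => x ⟨m + l, by omega⟩) := by
  ext k
  by_cases hk : k = m
  · subst hk
    simp [insertArgs]
  · simp [insertArgs, hk]

theorem insertOp_sum_right {ι : Type*} (s : Finset ι) (f : Op K V (a + 1))
    (g : ι → Op K V (b + 1)) (e : ℤ) (m : Fin (a + 1)) :
    insertOp 𝒱 h f (∑ i ∈ s, g i) e m = ∑ i ∈ s, insertOp 𝒱 h f (g i) e m := by
  ext x
  simp only [insertOp_apply, _root_.sum_apply]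
  rw [insertArgs_eq_update 𝒱 h _ 0, _root_.sum_apply, f.map_update_sum]
  refine Finset.sum_congr rfl fun i _ => ?_
  rw [← insertArgs_eq_update]

/-- The degrees of the arguments of the outer operation in `f ∘ (I_m ⊗ g ⊗ I_{a-m})`. -/
def insertDegrees (e : ℤ) (m : Fin (a + 1)) (d : Fin (n + 1) → ℤ) (k : Fin (a + 1)) : ℤ :=
  if k < m then d ⟨k, by omega⟩
  else if k = m then (∑ l : Fin (b + 1), d ⟨m + l, by omega⟩) + e
  else d ⟨k + b, by omega⟩

variable {𝒱}

theorem insertArgs_mem {g : Op K V (b + 1)} {e : ℤ} (hg : IsHomogeneousOfDegree 𝒱 g e)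
    (m : Fin (a + 1)) {d : Fin (n + 1) → ℤ} {x : Fin (n + 1) → V} (hx : ∀ k, x k ∈ 𝒱 (d k))
    (k : Fin (a + 1)) : insertArgs 𝒱 h g e m x k ∈ 𝒱 (insertDegrees h e m d k) := by
  unfold insertArgs insertDegrees
  split_ifs
  · rw [passSign_apply 𝒱 e _ (hx _)]
    exact Submodule.smul_mem _ _ (hx _)
  · exact hg _ _ fun l => hx _
  · exact hx _

variable (𝒱)

/-- `(-1) ^ (j (i - m - 1) + m) f ∘ (I_m ⊗ g ⊗ I_{i-m-1})`, where `f` has `i = a + 1` inputs and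
`g` has `j = b + 1` inputs and degree `e`. -/
def signedInsertion (f : Op K V (a + 1)) (g : Op K V (b + 1)) (e : ℤ) (m : Fin (a + 1)) :
    Op K V (n + 1) :=
  ((-1 : K) ^ ((b + 1) * (a - (m : ℕ)) + (m : ℕ))) • insertOp 𝒱 h f g e m

end

/-! ### Adjacent transpositions and insertions -/

section

variable (𝒱 : ℤ → Submodule K V) [DirectSum.Decomposition 𝒱] {a b n : ℕ} (h : a + b = n)

theorem apply_update_smul_self {N : ℕ} (f : Op K V N) (y : Fin N → V) (k : Fin N)
    (c : K) : f (Function.update y k (c • y k)) = c • f y := by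
  rw [f.map_update_smul, Function.update_eq_self]

/-- An adjacent transposition of inputs of the inner operation is one of inputs of the insertion. -/
theorem signedInsertion_compRho_swap_inner (k : Fin b) (f : Op K V (a + 1)) (g : Op K V (b + 1))
    (e : ℤ) (m : Fin (a + 1)) :
    signedInsertion 𝒱 h f (compRho 𝒱 (Equiv.swap k.castSucc k.succ) g) e m =
      compRho 𝒱 (Fin.cycleIcc ⟨m + k, by omega⟩ ⟨m + k + 1, by omega⟩)
        (signedInsertion 𝒱 h f g e m) := by
  rw [signedInsertion, signedInsertion, compRho_smul]
  congr 1
  refine op_ext_homogeneous 𝒱 fun d x hx => ?_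
  rw [compRho_cycleIcc_apply 𝒱 (n := n) (l := 1) _ _ d x hx, insertOp_apply, insertOp_apply,
    insertArgs_eq_update 𝒱 h _ g,
    compRho_swap_apply 𝒱 k g (fun l => d ⟨m + l, by omega⟩) _ fun l => hx _]
  -- The sign of the transposition is moved into slot m, where the other side has it.
  rw [← apply_update_smul_self f _ m]
  congr 1
  ext i
  rcases lt_trichotomy i.val m.val with hi | hi | hi
  · have hne : i ≠ m := fun hh => by simp [hh] at hi
    rw [Function.update_of_ne hne, Function.update_of_ne hne, insertArgs_of_lt 𝒱 h g e hi,
      insertArgs_of_lt 𝒱 h g e hi]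
    refine congrArg (fun v => passSign 𝒱 e (x v)) (Fin.ext ?_)
    simp only [val_cycleIcc]
    split_ifs <;> omega
  · obtain rfl : i = m := Fin.ext hi
    rw [Function.update_self, Function.update_self, insertArgs_of_eq 𝒱 h g e rfl]
    congr 1
    · rw [Fin.prod_univ_one, pow_one, neg_one_mul, mul_comm]
      rfl
    · refine congrArg g (funext fun l => congrArg x (Fin.ext ?_))
      simp only [swap_eq_cycleIcc, val_cycleIcc]
      split_ifs <;> omega
  · have hne : i ≠ m := fun hh => by simp [hh] at hi
    rw [Function.update_of_ne hne, Function.update_of_ne hne, insertArgs_of_gt 𝒱 h g e hi,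
      insertArgs_of_gt 𝒱 h g e hi]
    refine congrArg x (Fin.ext ?_)
    simp only [val_cycleIcc]
    split_ifs <;> omega

/-- An adjacent transposition of inputs of the outer operation before the inner one. -/
theorem signedInsertion_compRho_swap_of_lt {g : Op K V (b + 1)} {e : ℤ}
    (hg : IsHomogeneousOfDegree 𝒱 g e) (k : Fin a) (f : Op K V (a + 1)) {m : Fin (a + 1)}
    (hm : k.val + 1 < m) :
    signedInsertion 𝒱 h (compRho 𝒱 (Equiv.swap k.castSucc k.succ) f) g e m =
      compRho 𝒱 (Fin.cycleIcc ⟨k, by omega⟩ ⟨k + 1, by omega⟩)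
        (signedInsertion 𝒱 h f g e m) := by
  rw [signedInsertion, signedInsertion, compRho_smul]
  congr 1
  refine op_ext_homogeneous 𝒱 fun d x hx => ?_
  rw [compRho_cycleIcc_apply 𝒱 (n := n) (l := 1) _ _ d x hx, insertOp_apply, insertOp_apply,
    compRho_swap_apply 𝒱 k f _ _ fun l => insertArgs_mem h hg m hx l]
  congr 1
  · rw [Fin.prod_univ_one, pow_one, neg_one_mul, mul_comm]
    have h1 : k.castSucc < m := by simp only [Fin.lt_def, Fin.val_castSucc]; omega
    have h2 : k.succ < m := by simp only [Fin.lt_def, Fin.val_succ]; omega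
    simp [insertDegrees, h1, h2]
  congr 1
  ext i
  have hj := val_cycleIcc (n := a) (m := k) (l := 1) (by omega) i
  rw [swap_eq_cycleIcc]
  generalize Fin.cycleIcc _ _ i = j at hj ⊢
  rcases lt_trichotomy i.val m.val with hi | hi | hi
  · rw [insertArgs_of_lt 𝒱 h g e (by split_ifs at hj <;> omega), insertArgs_of_lt 𝒱 h g e hi]
    refine congrArg (fun v => passSign 𝒱 e (x v)) (Fin.ext ?_)
    simp only [val_cycleIcc, hj]
  · rw [insertArgs_of_eq 𝒱 h g e (by split_ifs at hj <;> omega), insertArgs_of_eq 𝒱 h g e hi]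
    refine congrArg g (funext fun l => congrArg x (Fin.ext ?_))
    simp only [val_cycleIcc]
    split_ifs <;> omega
  · rw [insertArgs_of_gt 𝒱 h g e (by split_ifs at hj <;> omega), insertArgs_of_gt 𝒱 h g e hi]
    refine congrArg x (Fin.ext ?_)
    simp only [val_cycleIcc, hj]
    split_ifs <;> omega

/-- An adjacent transposition of inputs of the outer operation after the inner one. -/
theorem signedInsertion_compRho_swap_of_gt {g : Op K V (b + 1)} {e : ℤ}
    (hg : IsHomogeneousOfDegree 𝒱 g e) (k : Fin a) (f : Op K V (a + 1)) {m : Fin (a + 1)}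
    (hm : m.val < k) :
    signedInsertion 𝒱 h (compRho 𝒱 (Equiv.swap k.castSucc k.succ) f) g e m =
      compRho 𝒱 (Fin.cycleIcc ⟨k + b, by omega⟩ ⟨k + b + 1, by omega⟩)
        (signedInsertion 𝒱 h f g e m) := by
  rw [signedInsertion, signedInsertion, compRho_smul]
  congr 1
  refine op_ext_homogeneous 𝒱 fun d x hx => ?_
  rw [compRho_cycleIcc_apply 𝒱 (n := n) (l := 1) _ _ d x hx, insertOp_apply, insertOp_apply,
    compRho_swap_apply 𝒱 k f _ _ fun l => insertArgs_mem h hg m hx l]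
  congr 1
  · rw [Fin.prod_univ_one, pow_one, neg_one_mul, mul_comm]
    have h1 : ¬ k.castSucc < m := by simp only [Fin.lt_def, Fin.val_castSucc]; omega
    have h2 : ¬ k.succ < m := by simp only [Fin.lt_def, Fin.val_succ]; omega
    have h3 : ¬ k.castSucc = m := by simp only [Fin.ext_iff, Fin.val_castSucc]; omega
    have h4 : ¬ k.succ = m := by simp only [Fin.ext_iff, Fin.val_succ]; omega
    simp [insertDegrees, h1, h2, h3, h4, add_right_comm]
  congr 1
  ext i
  have hj := val_cycleIcc (n := a) (m := k) (l := 1) (by omega) i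
  rw [swap_eq_cycleIcc]
  generalize Fin.cycleIcc _ _ i = j at hj ⊢
  rcases lt_trichotomy i.val m.val with hi | hi | hi
  · rw [insertArgs_of_lt 𝒱 h g e (by split_ifs at hj <;> omega), insertArgs_of_lt 𝒱 h g e hi]
    refine congrArg (fun v => passSign 𝒱 e (x v)) (Fin.ext ?_)
    simp only [val_cycleIcc, hj]
    split_ifs <;> omega
  · rw [insertArgs_of_eq 𝒱 h g e (by split_ifs at hj <;> omega), insertArgs_of_eq 𝒱 h g e hi]
    refine congrArg g (funext fun l => congrArg x (Fin.ext ?_))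
    simp only [val_cycleIcc]
    split_ifs <;> omega
  · rw [insertArgs_of_gt 𝒱 h g e (by split_ifs at hj <;> omega), insertArgs_of_gt 𝒱 h g e hi]
    refine congrArg x (Fin.ext ?_)
    simp only [val_cycleIcc, hj]
    split_ifs <;> omega

theorem negOnePow_mul_eq (e d : ℤ) :
    (e * d).negOnePow = (-1 : ℤˣ) ^ ((e : ZMod 2) * (d : ZMod 2)) := by
  rw [← Int.cast_mul, uzpow_intCast, Int.negOnePow]

theorem uzpow_sum {ι : Type*} (s : Finset ι) (u : ℤˣ) (f : ι → ZMod 2) :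
    u ^ (∑ i ∈ s, f i) = ∏ i ∈ s, u ^ f i := by
  classical
  induction s using Finset.induction_on with
  | empty => simp
  | insert i s hi ih => rw [Finset.sum_insert hi, Finset.prod_insert hi, uzpow_add, ih]

/-- The transposition of the inner operation and the input before it is the cyclic permutation that
moves this input past all inputs of the inner operation. -/
theorem signedInsertion_compRho_swap_succ {g : Op K V (b + 1)} {e : ℤ}
    (hg : IsHomogeneousOfDegree 𝒱 g e) (k : Fin a) (f : Op K V (a + 1)) :
    signedInsertion 𝒱 h (compRho 𝒱 (Equiv.swap k.castSucc k.succ) f) g e k.succ =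
      compRho 𝒱 (Fin.cycleIcc ⟨k, by omega⟩ ⟨k + (b + 1), by omega⟩)
        (signedInsertion 𝒱 h f g e k.castSucc) := by
  rw [signedInsertion, signedInsertion, compRho_smul]
  refine op_ext_homogeneous 𝒱 fun d x hx => ?_
  rw [_root_.smul_apply, _root_.smul_apply, compRho_cycleIcc_apply 𝒱 (n := n) _ _ d x hx,
    insertOp_apply, insertOp_apply,
    compRho_swap_apply 𝒱 k f _ _ fun l => insertArgs_mem h hg k.succ hx l]
  -- On the left the input x_k precedes the inner operation and carries the pass sign; after the
  -- swap it sits in slot k + 1, where on the right it appears without that sign. All other slots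
  -- agree.
  have key : (fun i => insertArgs 𝒱 h g e k.succ x (Equiv.swap k.castSucc k.succ i)) =
      Function.update (insertArgs 𝒱 h g e k.castSucc
          fun i => x (Fin.cycleIcc ⟨k, by omega⟩ ⟨k + (b + 1), by omega⟩ i)) k.succ
        ((((e * d ⟨k, by omega⟩).negOnePow : ℤ) : K) • insertArgs 𝒱 h g e k.castSucc
          (fun i => x (Fin.cycleIcc ⟨k, by omega⟩ ⟨k + (b + 1), by omega⟩ i)) k.succ) := by
    ext i
    have hj := val_cycleIcc (n := a) (m := k) (l := 1) (by omega) i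
    have hs := Fin.val_succ k
    have hc := Fin.val_castSucc k
    rw [swap_eq_cycleIcc]
    generalize Fin.cycleIcc (⟨k, _⟩ : Fin (a + 1)) _ i = j at hj ⊢
    rcases lt_trichotomy i.val (k.val + 1) with hi1 | hi1 | hi1
    · rw [Function.update_of_ne (Fin.ext_iff.not.mpr (by omega))]
      by_cases hi2 : i.val < k.val
      · rw [insertArgs_of_lt 𝒱 h g e (by split_ifs at hj; omega),
          insertArgs_of_lt 𝒱 h g e (by omega)]
        refine congrArg (fun v => passSign 𝒱 e (x v)) (Fin.ext ?_)
        simp only [val_cycleIcc, hj]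
        split_ifs; omega
      · rw [insertArgs_of_eq 𝒱 h g e (by split_ifs at hj; omega),
          insertArgs_of_eq 𝒱 h g e (by omega)]
        refine congrArg g (funext fun l => congrArg x (Fin.ext ?_))
        simp only [val_cycleIcc, Fin.val_succ, Fin.val_castSucc]
        split_ifs <;> omega
    · obtain rfl : i = k.succ := Fin.ext hi1
      obtain rfl : j = k.castSucc := Fin.ext (by split_ifs at hj <;> omega)
      rw [Function.update_self, insertArgs_of_lt 𝒱 h g e (by omega),
        insertArgs_of_gt 𝒱 h g e (by omega), passSign_apply 𝒱 e _ (hx _)]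
      refine congrArg (fun v => (((e * d ⟨k, by omega⟩).negOnePow : ℤ) : K) • x v) (Fin.ext ?_)
      simp only [val_cycleIcc, Fin.val_succ, Fin.val_castSucc]
      split_ifs <;> omega
    · rw [Function.update_of_ne (Fin.ext_iff.not.mpr (by omega)),
        insertArgs_of_gt 𝒱 h g e (by split_ifs at hj <;> omega),
        insertArgs_of_gt 𝒱 h g e (by omega)]
      refine congrArg x (Fin.ext ?_)
      simp only [val_cycleIcc, hj]
      split_ifs <;> omega
  rw [key, apply_update_smul_self, smul_smul, smul_smul, smul_smul]
  congr 1
  have hd1 : insertDegrees h e k.succ d k.castSucc = d ⟨k, by omega⟩ := by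
    simp [insertDegrees]
  have hd2 : insertDegrees h e k.succ d k.succ =
      (∑ l : Fin (b + 1), d ⟨k + l + 1, by omega⟩) + e := by
    simp [insertDegrees, add_right_comm]
  rw [hd1, hd2, negOnePow_mul_eq, Int.cast_add, Int.cast_sum, mul_add, uzpow_add, Finset.mul_sum,
    uzpow_sum, mul_comm (e : ZMod 2)]
  simp only [mul_comm ((d ⟨k, by omega⟩ : ℤ) : ZMod 2)]
  generalize (∏ i : Fin (b + 1), (-1 : ℤˣ) ^ (((d ⟨k + i + 1, by omega⟩ : ℤ) : ZMod 2) *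
    ((d ⟨k, by omega⟩ : ℤ) : ZMod 2))) = P
  generalize (-1 : ℤˣ) ^ ((e : ZMod 2) * ((d ⟨k, by omega⟩ : ℤ) : ZMod 2)) = Q
  have hQ : ((Q : ℤ) : K) * ((Q : ℤ) : K) = 1 := by
    rcases Int.units_eq_one_or Q with rfl | rfl <;> simp
  -- The number c of slots after k + 1 removes the truncated subtractions from the exponents.
  obtain ⟨c, hc⟩ : ∃ c, a = k + 1 + c := ⟨a - (k + 1), by omega⟩
  have e1 : a - k.succ.val = c := by rw [Fin.val_succ]; omega
  have e2 : a - k.castSucc.val = c + 1 := by rw [Fin.val_castSucc]; omega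
  rw [e1, e2, Fin.val_succ, Fin.val_castSucc]
  push_cast
  have hB : ((-1 : K) ^ (b + 1)) * (-1) ^ (b + 1) = 1 := by
    rw [← mul_pow]; simp
  -- The pass sign Q cancels the Koszul sign of e, by `hQ`. What remains is -1 from the
  -- transposition against (-1)^(b+1) from the cycle, and the change of coefficient between slots k
  -- and k + 1 makes up the difference, by `hB`.
  linear_combination (-((-1 : K) ^ ((b + 1) * c + (k + 1))) * P) * hQ -
    ((-1 : K) ^ ((b + 1) * c + k) * P) * hB

end

/-! ### From adjacent transpositions to all permutations -/

theorem perm_induction {a : ℕ} {P : Equiv.Perm (Fin (a + 1)) → Prop} (one : P 1)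
    (mul : ∀ σ τ, P σ → P τ → P (σ * τ))
    (swap : ∀ k : Fin a, P (Equiv.swap k.castSucc k.succ)) (σ : Equiv.Perm (Fin (a + 1))) :
    P σ := by
  have hσ : σ ∈ Submonoid.closure
      (Set.range fun i : Fin a => Equiv.swap i.castSucc i.succ) := by
    rw [Equiv.Perm.mclosure_swap_castSucc_succ]
    trivial
  induction hσ using Submonoid.closure_induction with
  | mem x hx =>
    obtain ⟨k, rfl⟩ := hx
    exact swap k
  | one => exact one
  | mul x y _ _ hx hy => exact mul x y hx hy

theorem fixLast_swap {a : ℕ} (u v : Fin a) :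
    fixLast (Equiv.swap u v) = Equiv.swap u.castSucc v.castSucc := by
  rw [fixLast, Equiv.optionCongr_swap]
  ext i : 1
  simp only [Equiv.permCongr_apply, Equiv.symm_symm]
  rw [Equiv.symm_apply_eq, ← finSuccEquivLast_castSucc, ← finSuccEquivLast_castSucc,
    finSuccEquivLast.injective.swap_apply]

/-- The permutations fixing the last letter are generated by the adjacent transpositions that do not
involve it, whence the bound on k. -/
theorem perm_induction_fixLast {a : ℕ} {P : Equiv.Perm (Fin (a + 1)) → Prop} (one : P 1)
    (mul : ∀ σ τ, P σ → P τ → P (σ * τ))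
    (swap : ∀ k : Fin a, k.val + 1 < a → P (Equiv.swap k.castSucc k.succ))
    (σ : Equiv.Perm (Fin a)) : P (fixLast σ) := by
  have one' : P (fixLast 1) := by rwa [← fixLastHom_apply, map_one]
  cases a with
  | zero => rwa [Subsingleton.elim σ 1]
  | succ a =>
    refine perm_induction (P := fun σ => P (fixLast σ)) one' (fun σ τ hσ hτ => ?_) (fun k => ?_) σ
    · rw [← fixLastHom_apply, map_mul]
      exact mul _ _ hσ hτ
    · rw [fixLast_swap]
      exact swap k.castSucc (by simp)

theorem cycleIcc_last {n i j : ℕ} (hi : i < n + 1) (hj : j < n) :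
    Fin.cycleIcc (⟨i, hi⟩ : Fin (n + 1)) ⟨j, by omega⟩ (Fin.last n) = Fin.last n :=
  Fin.cycleIcc_of_gt (Fin.lt_def.mpr hj)

section

variable (𝒱 : ℤ → Submodule K V) [DirectSum.Decomposition 𝒱] {a b n : ℕ} (h : a + b = n)

/-- Permuting the inputs of the outer operation of an insertion by `σ` amounts to permuting the
inputs of another insertion by an element of `H`. -/
def OuterCompatible (g : Op K V (b + 1)) (e : ℤ) (H : Subgroup (Equiv.Perm (Fin (n + 1))))
    (σ : Equiv.Perm (Fin (a + 1))) : Prop :=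
  ∀ m : Fin (a + 1), ∃ π ∈ H, ∀ f : Op K V (a + 1),
    signedInsertion 𝒱 h (compRho 𝒱 σ f) g e m =
      compRho 𝒱 π (signedInsertion 𝒱 h f g e (σ⁻¹ m))

/-- Permuting the inputs of the inner operation of an insertion by `τ` amounts to permuting the
inputs of the insertion by an element of `H`. -/
def InnerCompatible (f : Op K V (a + 1)) (e : ℤ) (H : Subgroup (Equiv.Perm (Fin (n + 1))))
    (τ : Equiv.Perm (Fin (b + 1))) : Prop :=
  ∀ m : Fin (a + 1), ∃ π ∈ H, ∀ g : Op K V (b + 1),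
    signedInsertion 𝒱 h f (compRho 𝒱 τ g) e m = compRho 𝒱 π (signedInsertion 𝒱 h f g e m)

variable {𝒱 h} {H : Subgroup (Equiv.Perm (Fin (n + 1)))}

theorem OuterCompatible.one (g : Op K V (b + 1)) (e : ℤ) : OuterCompatible 𝒱 h g e H 1 :=
  fun m => ⟨1, H.one_mem, fun f => by rw [compRho_one, compRho_one]; rfl⟩

theorem OuterCompatible.mul {g : Op K V (b + 1)} {e : ℤ} {σ τ : Equiv.Perm (Fin (a + 1))}
    (hσ : OuterCompatible 𝒱 h g e H σ) (hτ : OuterCompatible 𝒱 h g e H τ) :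
    OuterCompatible 𝒱 h g e H (σ * τ) := by
  intro m
  obtain ⟨π, hπ, h1⟩ := hσ m
  obtain ⟨π', hπ', h2⟩ := hτ (σ⁻¹ m)
  refine ⟨π * π', H.mul_mem hπ hπ', fun f => ?_⟩
  rw [compRho_mul, h1, h2, compRho_mul, mul_inv_rev, Equiv.Perm.mul_apply]

theorem InnerCompatible.one (f : Op K V (a + 1)) (e : ℤ) : InnerCompatible 𝒱 h f e H 1 :=
  fun m => ⟨1, H.one_mem, fun g => by rw [compRho_one, compRho_one]⟩

theorem InnerCompatible.mul {f : Op K V (a + 1)} {e : ℤ} {σ τ : Equiv.Perm (Fin (b + 1))}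
    (hσ : InnerCompatible 𝒱 h f e H σ) (hτ : InnerCompatible 𝒱 h f e H τ) :
    InnerCompatible 𝒱 h f e H (σ * τ) := by
  intro m
  obtain ⟨π, hπ, h1⟩ := hσ m
  obtain ⟨π', hπ', h2⟩ := hτ m
  refine ⟨π * π', H.mul_mem hπ hπ', fun g => ?_⟩
  rw [compRho_mul, h1, h2, compRho_mul]

/-- The slot m lies before, at, or after the transposed pair, and each position has its own π. If
the transposition avoids the last slot of the outer operation, each such π fixes the last letter, so
one hypothesis on H serves both the full group and the subgroup fixing that letter. -/
theorem outerCompatible_swap {g : Op K V (b + 1)} {e : ℤ} (hg : IsHomogeneousOfDegree 𝒱 g e)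
    (k : Fin a)
    (hH : ∀ π : Equiv.Perm (Fin (n + 1)), (k.val + 1 < a → π (Fin.last n) = Fin.last n) → π ∈ H) :
    OuterCompatible 𝒱 h g e H (Equiv.swap k.castSucc k.succ) := by
  have hsucc := signedInsertion_compRho_swap_succ 𝒱 h hg k
  have hc : (Fin.cycleIcc ⟨k, by omega⟩ ⟨k + (b + 1), by omega⟩ : Equiv.Perm (Fin (n + 1))) ∈ H :=
    hH _ fun hk => cycleIcc_last _ (by omega)
  intro m
  rw [Equiv.swap_inv]
  rcases lt_trichotomy m.val k.val with hm | hm | hm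
  · rw [Equiv.swap_apply_of_ne_of_ne (Fin.ext_iff.not.mpr (by simp; omega))
      (Fin.ext_iff.not.mpr (by simp; omega))]
    exact ⟨_, hH _ fun hk => cycleIcc_last _ (by omega),
      fun f => signedInsertion_compRho_swap_of_gt 𝒱 h hg k f hm⟩
  · obtain rfl : m = k.castSucc := Fin.ext hm
    rw [Equiv.swap_apply_left]
    refine ⟨_, H.inv_mem hc, fun f => ?_⟩
    -- The case m = k is the inverse of the case m = k + 1: apply the latter to the already
    -- transposed f.
    have := hsucc (compRho 𝒱 (Equiv.swap k.castSucc k.succ) f)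
    rw [← compRho_mul, Equiv.swap_mul_self, compRho_one] at this
    rw [this, ← compRho_mul, inv_mul_cancel, compRho_one]
  rcases eq_or_lt_of_le (Nat.succ_le_of_lt hm) with hm | hm
  · obtain rfl : m = k.succ := Fin.ext hm.symm
    rw [Equiv.swap_apply_right]
    exact ⟨_, hc, hsucc⟩
  · rw [Equiv.swap_apply_of_ne_of_ne (Fin.ext_iff.not.mpr (by simp; omega))
      (Fin.ext_iff.not.mpr (by simp; omega))]
    exact ⟨_, hH _ fun hk => cycleIcc_last _ (by omega),
      fun f => signedInsertion_compRho_swap_of_lt 𝒱 h hg k f hm⟩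

theorem innerCompatible_swap (f : Op K V (a + 1)) (e : ℤ) (k : Fin b)
    (hH : ∀ π : Equiv.Perm (Fin (n + 1)), (k.val + 1 < b → π (Fin.last n) = Fin.last n) → π ∈ H) :
    InnerCompatible 𝒱 h f e H (Equiv.swap k.castSucc k.succ) := fun m =>
  ⟨_, hH _ fun hk => cycleIcc_last _ (by omega),
    fun g => signedInsertion_compRho_swap_inner 𝒱 h k f g e m⟩

theorem outerCompatible_top {g : Op K V (b + 1)} {e : ℤ} (hg : IsHomogeneousOfDegree 𝒱 g e)
    (σ : Equiv.Perm (Fin (a + 1))) : OuterCompatible 𝒱 h g e ⊤ σ :=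
  perm_induction (OuterCompatible.one g e) (fun _ _ => OuterCompatible.mul)
    (fun k => outerCompatible_swap hg k fun _ _ => Subgroup.mem_top _) σ

theorem innerCompatible_top (f : Op K V (a + 1)) (e : ℤ) (τ : Equiv.Perm (Fin (b + 1))) :
    InnerCompatible 𝒱 h f e ⊤ τ :=
  perm_induction (InnerCompatible.one f e) (fun _ _ => InnerCompatible.mul)
    (fun k => innerCompatible_swap f e k fun _ _ => Subgroup.mem_top _) τ

theorem outerCompatible_fixLast {g : Op K V (b + 1)} {e : ℤ}
    (hg : IsHomogeneousOfDegree 𝒱 g e) (σ : Equiv.Perm (Fin a)) :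
    OuterCompatible 𝒱 h g e (fixLastHom n).range (fixLast σ) :=
  perm_induction_fixLast (OuterCompatible.one g e) (fun _ _ => OuterCompatible.mul)
    (fun k hk => outerCompatible_swap hg k fun _ hπ => mem_range_fixLastHom (hπ hk)) σ

theorem innerCompatible_fixLast (f : Op K V (a + 1)) (e : ℤ) (τ : Equiv.Perm (Fin b)) :
    InnerCompatible 𝒱 h f e (fixLastHom n).range (fixLast τ) :=
  perm_induction_fixLast (InnerCompatible.one f e) (fun _ _ => InnerCompatible.mul)
    (fun k hk => innerCompatible_swap f e k fun _ hπ => mem_range_fixLastHom (hπ hk)) τ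

variable (𝒱 h)

theorem signedInsertion_sum {ι κ : Type*} [Fintype ι] [Fintype κ] (f : ι → Op K V (a + 1))
    (g : κ → Op K V (b + 1)) (e : ℤ) (m : Fin (a + 1)) :
    signedInsertion 𝒱 h (∑ i, f i) (∑ j, g j) e m =
      ∑ i, ∑ j, signedInsertion 𝒱 h (f i) (g j) e m := by
  simp only [signedInsertion, insertOp_sum_left, insertOp_sum_right, Finset.smul_sum]
  exact Finset.sum_comm

end

/-! ### Symmetrization over a group -/

section

variable (𝒱 : ℤ → Submodule K V) [DirectSum.Decomposition 𝒱] {a b n : ℕ} (h : a + b = n)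
  {G : Type*} [Group G] [Fintype G]

/-- `F ∘ ∑_s ρ_{φ(s)}`, where `s` runs through a group acting on the inputs through `φ`. -/
def symmetrize (φ : G →* Equiv.Perm (Fin n)) (F : Op K V n) : Op K V n :=
  ∑ s, compRho 𝒱 (φ s) F

theorem symmetrize_sum (φ : G →* Equiv.Perm (Fin n)) {ι : Type*} (s : Finset ι)
    (F : ι → Op K V n) : symmetrize 𝒱 φ (∑ i ∈ s, F i) = ∑ i ∈ s, symmetrize 𝒱 φ (F i) := by
  simp only [symmetrize, compRho_sum]
  exact Finset.sum_comm

theorem symmetrize_smul (φ : G →* Equiv.Perm (Fin n)) (c : K) (F : Op K V n) :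
    symmetrize 𝒱 φ (c • F) = c • symmetrize 𝒱 φ F := by
  simp only [symmetrize, compRho_smul, Finset.smul_sum]

theorem symmetrize_zero (φ : G →* Equiv.Perm (Fin n)) :
    symmetrize 𝒱 φ (0 : Op K V n) = 0 := by
  simpa using symmetrize_smul 𝒱 φ 0 (0 : Op K V n)

theorem symmetrize_compRho (φ : G →* Equiv.Perm (Fin n)) {π : Equiv.Perm (Fin n)}
    (hπ : π ∈ φ.range) (F : Op K V n) :
    symmetrize 𝒱 φ (compRho 𝒱 π F) = symmetrize 𝒱 φ F := by
  obtain ⟨t, rfl⟩ := hπ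
  simp only [symmetrize, ← compRho_mul, ← map_mul]
  exact Equiv.sum_comp (Equiv.mulRight t) fun s => compRho 𝒱 (φ s) F

theorem compRho_symmetrize (φ : G →* Equiv.Perm (Fin n)) {π : Equiv.Perm (Fin n)}
    (hπ : π ∈ φ.range) (F : Op K V n) :
    compRho 𝒱 π (symmetrize 𝒱 φ F) = symmetrize 𝒱 φ F := by
  obtain ⟨t, rfl⟩ := hπ
  simp only [symmetrize, compRho_sum, ← compRho_mul, ← map_mul]
  exact Equiv.sum_comp (Equiv.mulLeft t) fun s => compRho 𝒱 (φ s) F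

/-- After symmetrization, permuting the inputs of the two operations does not change the signed sum
of all insertions. -/
theorem symmetrize_signedInsertion_sum (φ : G →* Equiv.Perm (Fin (n + 1))) {ι κ : Type*}
    [Fintype ι] [Fintype κ] {ρ : ι → Equiv.Perm (Fin (a + 1))} {τ : κ → Equiv.Perm (Fin (b + 1))}
    {f : Op K V (a + 1)} {g : Op K V (b + 1)} {e : ℤ} (hg : IsHomogeneousOfDegree 𝒱 g e)
    (hρ : ∀ i (g' : Op K V (b + 1)), IsHomogeneousOfDegree 𝒱 g' e →
      OuterCompatible 𝒱 h g' e φ.range (ρ i))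
    (hτ : ∀ j, InnerCompatible 𝒱 h f e φ.range (τ j)) :
    symmetrize 𝒱 φ (∑ m, signedInsertion 𝒱 h (∑ i, compRho 𝒱 (ρ i) f)
        (∑ j, compRho 𝒱 (τ j) g) e m) =
      ((Fintype.card ι : K) * (Fintype.card κ : K)) •
        symmetrize 𝒱 φ (∑ m, signedInsertion 𝒱 h f g e m) := by
  have key : ∀ m i j, symmetrize 𝒱 φ
      (signedInsertion 𝒱 h (compRho 𝒱 (ρ i) f) (compRho 𝒱 (τ j) g) e m) =
      symmetrize 𝒱 φ (signedInsertion 𝒱 h f g e ((ρ i)⁻¹ m)) := by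
    intro m i j
    -- The outer permutation is removed while the inner operation is still permuted, which is why
    -- `hρ` ranges over all operations of degree e.
    obtain ⟨π, hπ, h1⟩ := hρ i _ (hg.compRho (τ j)) m
    obtain ⟨π', hπ', h2⟩ := hτ j ((ρ i)⁻¹ m)
    rw [h1, symmetrize_compRho 𝒱 φ hπ, h2, symmetrize_compRho 𝒱 φ hπ']
  simp only [signedInsertion_sum, symmetrize_sum, key, Finset.sum_const, Finset.card_univ]
  rw [Finset.sum_comm]
  -- For fixed i the slot (ρ i)⁻¹ m runs through all slots once.
  have hreindex : ∀ i, ∑ m, Fintype.card κ •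
      symmetrize 𝒱 φ (signedInsertion 𝒱 h f g e ((ρ i)⁻¹ m)) =
      ∑ m, Fintype.card κ • symmetrize 𝒱 φ (signedInsertion 𝒱 h f g e m) := fun i =>
    Equiv.sum_comp (ρ i)⁻¹ fun m =>
      Fintype.card κ • symmetrize 𝒱 φ (signedInsertion 𝒱 h f g e m)
  simp only [hreindex, Finset.sum_const, Finset.card_univ, ← Finset.smul_sum]
  rw [mul_smul, Nat.cast_smul_eq_nsmul, Nat.cast_smul_eq_nsmul]

end

/-! ### From A_∞ to PL_∞ and from PL_∞ to L_∞ -/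

theorem isPLInfinity_gammaOp [CharZero K] (𝒱 : ℤ → Submodule K V) [DirectSum.Decomposition 𝒱]
    {μ : Ops K V} (hμ : IsAInfinity 𝒱 μ) : IsPLInfinity 𝒱 (gammaOp 𝒱 μ) where
  degree n := IsHomogeneousOfDegree.sum fun σ _ => (hμ.degree n).compRho _
  symmetry n σ := compRho_symmetrize 𝒱 (fixLastHom n) ⟨σ, rfl⟩ (μ n)
  relation n := by
    calc _ = ∑ p : antidiagonal n, symmetrize 𝒱 (fixLastHom n)
          (signedInsertions 𝒱 μ (mem_antidiagonal.mp p.2)) := by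
          refine Finset.sum_congr rfl fun p _ => ?_
          have := symmetrize_signedInsertion_sum 𝒱 (mem_antidiagonal.mp p.2) (fixLastHom n)
            (f := μ p.1.1) (hμ.degree p.1.2) (fun σ _ hg => outerCompatible_fixLast hg σ)
            (fun τ => innerCompatible_fixLast _ _ τ)
          refine (congrArg _ this).trans ?_
          -- The numbers of permuted copies are a! and b!, which cancel the coefficient.
          rw [smul_smul, Fintype.card_perm, Fintype.card_perm, Fintype.card_fin, Fintype.card_fin,
            one_div_mul_cancel, one_smul]
          · rfl
          · exact mul_ne_zero (Nat.cast_ne_zero.mpr (Nat.factorial_ne_zero _))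
              (Nat.cast_ne_zero.mpr (Nat.factorial_ne_zero _))
      _ = 0 := by rw [← symmetrize_sum, hμ.relation, symmetrize_zero]

theorem isLInfinity_betaOp [CharZero K] (𝒱 : ℤ → Submodule K V) [DirectSum.Decomposition 𝒱]
    {μ : Ops K V} (hμ : IsPLInfinity 𝒱 μ) : IsLInfinity 𝒱 (betaOp 𝒱 μ) where
  degree n := IsHomogeneousOfDegree.sum fun σ _ => (hμ.degree n).compRho _
  symmetry n π := by
    rw [betaOp_eq_sum_unshuffle]
    exact compRho_sum_unshuffle 𝒱 (hμ.symmetry n) π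
  relation n := by
    have hfac : ∀ k : ℕ, (k.factorial : K) ≠ 0 := fun k =>
      Nat.cast_ne_zero.mpr k.factorial_ne_zero
    let φ := MonoidHom.id (Equiv.Perm (Fin (n + 1)))
    have hφ : φ.range = ⊤ := MonoidHom.range_eq_top.mpr Function.surjective_id
    have hrel : ∑ p : antidiagonal n, (1 / ((p.1.1.factorial : K) * (p.1.2.factorial : K))) •
        symmetrize 𝒱 φ (signedInsertions 𝒱 μ (mem_antidiagonal.mp p.2)) = 0 := by
      -- Symmetrizing over the full group makes all n! terms of the inner sum equal; the factor n!
      -- is then divided out.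
      have := congrArg (symmetrize 𝒱 φ) (hμ.relation n)
      simp only [symmetrize_sum, symmetrize_smul, symmetrize_zero,
        symmetrize_compRho 𝒱 φ (hφ ▸ Subgroup.mem_top _ : _ ∈ φ.range), Finset.sum_const,
        Finset.card_univ, Fintype.card_perm, Fintype.card_fin, smul_comm _ n.factorial,
        ← Finset.smul_sum] at this
      rw [← Nat.cast_smul_eq_nsmul K] at this
      exact (smul_eq_zero.mp this).resolve_left (hfac n)
    rw [← hrel]
    refine Finset.sum_congr rfl fun p _ => ?_
    have := symmetrize_signedInsertion_sum 𝒱 (mem_antidiagonal.mp p.2) φ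
      (f := μ p.1.1) (ρ := unshuffle) (τ := unshuffle) (hμ.degree p.1.2)
      (fun σ _ hg => hφ ▸ outerCompatible_top hg _) (fun τ => hφ ▸ innerCompatible_top _ _ _)
    simp only [← betaOp_eq_sum_unshuffle] at this
    refine (congrArg _ this).trans ?_
    -- There are a + 1 and b + 1 unshuffles, and (a + 1)! = (a + 1) a!, so the factorials drop to
    -- those of the PL_∞ relation.
    rw [smul_smul, Fintype.card_fin, Fintype.card_fin, Nat.factorial_succ, Nat.factorial_succ]
    congr 1
    have h1 := hfac p.1.1
    have h2 := hfac p.1.2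
    have h3 : ((p.1.1 + 1 : ℕ) : K) ≠ 0 := Nat.cast_ne_zero.mpr (Nat.succ_ne_zero _)
    have h4 : ((p.1.2 + 1 : ℕ) : K) ≠ 0 := Nat.cast_ne_zero.mpr (Nat.succ_ne_zero _)
    rw [Nat.cast_mul, Nat.cast_mul]
    field_simp

end HomotopyAlg

theorem corollary4p3 {K V : Type*} [Field K] [CharZero K] [AddCommGroup V] [Module K V]
    (𝒱 : ℤ → Submodule K V) [DirectSum.Decomposition 𝒱] :
    (∀ m : HomotopyAlg.Ops K V, HomotopyAlg.IsAInfinity 𝒱 m →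
      HomotopyAlg.IsPLInfinity 𝒱 (HomotopyAlg.gammaOp 𝒱 m)) ∧
    (∀ p : HomotopyAlg.Ops K V, HomotopyAlg.IsPLInfinity 𝒱 p →
      HomotopyAlg.IsLInfinity 𝒱 (HomotopyAlg.betaOp 𝒱 p)) :=
  ⟨fun _ hm => HomotopyAlg.isPLInfinity_gammaOp 𝒱 hm,
    fun _ hp => HomotopyAlg.isLInfinity_betaOp 𝒱 hp⟩
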